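/- Let $\Lambda$ be the set of all (open or closed) untyped $\lambda$-terms modulo $\alpha$-equivalence, over the variables $x_0,x_1,\dots$. A term $M$ is *solvable* if $(\lambda y_1\dots y_m.M)N_1\cdots N_k=_\beta I$ for some variables $y_i$ and terms $N_j$, where $I=\lambda x.x$; otherwise it is *unsolvable*. Contexts are given by $\mathtt C::=[-]\mid x\mid \mathtt C\,\mathtt C\mid\lambda x.\mathtt C$, and $\mathtt C[M]$ is obtained by filling every hole with $M$, where binders of $\mathtt C$ may capture free variables of $M$. Let $(\mathtt C_n)_{n\in\mathbb N}$ be any enumeration (possibly with repetitions) of all contexts, and put $$p_{\mathrm{ctx}}(M,N)=\sum\{2^{-n}\mid n\in\mathbb N,\ \mathtt C_n[M]\text{ is unsolvable or }\mathtt C_n[N]\text{ is unsolvable}\}.$$ For a function $p:X\times X\to[0,+\infty]$, write $x\le_p y$ if $p(x,y)\le p(x,x)$, and $x\simeq_p y$ if $x\le_p y$ and $y\le_p x$. The open balls of $p$ are the sets $B^p_\varepsilon(x)=\{y\mid p(y,x)<p(x,x)+\varepsilon\}$ with $0<\varepsilon<\infty$, and the open sets of $p$ are the unions of open balls. A point $x$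 is *generic* for $p$ if $x\le_p y$ for all $y\in X$. **Proposition.** $p_{\mathrm{ctx}}$ is a sensible, extensional $\lambda$-PPM. That is: 1. $p=p_{\mathrm{ctx}}$ is a partial pseudo-metric on $\Lambda$: for all $M,N,P$, $p(M,M)\le p(M,N)$, $p(M,N)=p(N,M)$ and $p(M,N)+p(P,P)\le p(M,P)+p(P,N)$; 2. $\simeq_{p_{\mathrm{ctx}}}$ is an extensional $\lambda$-theory: it is an equivalence relation on $\Lambda$, and for all terms $M,N,P$ and variables $x$, $M\simeq N$ implies $MP\simeq NP$, $PM\simeq PN$ and $\lambda x.M\simeq\lambda x.N$; $(\lambda x.M)N\simeq M[N/x]$; and $M\simeq\lambda x.Mx$ whenever $x$ is not free in $M$; 3. for every context $\mathtt C$, the map $M\mapsto\mathtt C[M]$ is continuous from $\Lambda$ to $\Lambda$: preimages of open sets of $p_{\mathrm{ctx}}$ are open sets of $p_{\mathrm{ctx}}$; 4. every unsolvable term is generic for $p_{\mathrm{ctx}}$, and no solvable term is. -/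

import Mathlib

open scoped ENNReal NNReal

namespace LambdaCalc

/-! ### Terms of the untyped lambda-calculus

The variables are `x₀, x₁, x₂, …`. Terms are taken modulo alpha-equivalence, in the de Bruijn
representation: an index pointing beyond all enclosing binders, to position `k`, is the free
variable `x_k`. -/

/-- The set `Λ` of all (open or closed) lambda-terms modulo alpha-equivalence. -/
inductive Term : Type
  | var : ℕ → Term
  | app : Term → Term → Term
  | lam : Term → Term

namespace Term

/-- Extension of a renaming under a binder. -/
def upRen (ρ : ℕ → ℕ) : ℕ → ℕ
  | 0 => 0
  | i + 1 => ρ i + 1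

/-- Renaming of free variables. -/
def rename : (ℕ → ℕ) → Term → Term
  | ρ, var i => var (ρ i)
  | ρ, app M N => app (rename ρ M) (rename ρ N)
  | ρ, lam M => lam (rename (upRen ρ) M)

/-- Extension of a substitution under a binder. -/
def up (σ : ℕ → Term) : ℕ → Term
  | 0 => var 0
  | i + 1 => rename Nat.succ (σ i)

/-- Simultaneous capture-avoiding substitution of free variables. -/
def subst : (ℕ → Term) → Term → Term
  | σ, var i => σ i
  | σ, app M N => app (subst σ M) (subst σ N)
  | σ, lam M => lam (subst (up σ) M)

/-- `inst M N` substitutes `N` for the outermost bound index in the body `M` of `lam M`. -/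
def inst (M N : Term) : Term :=
  subst (fun i => Nat.casesOn i N var) M

/-- `FreeIn x M`: the variable `x` occurs free in `M`. -/
def FreeIn : ℕ → Term → Prop
  | x, var y => x = y
  | x, app M N => FreeIn x M ∨ FreeIn x N
  | x, lam M => FreeIn (x + 1) M

/-- The abstraction `λx.M` of the free variable `x` in `M`. -/
def abs (x : ℕ) (M : Term) : Term :=
  lam (rename (fun i => if i = x then 0 else i + 1) M)

/-- The capture-avoiding substitution `M[N/x]` of `N` for the free variable `x` in `M`. -/
def substVar (x : ℕ) (N M : Term) : Term :=
  subst (fun i => if i = x then N else var i) M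

/-- The iterated abstraction `λx₁.⋯λxₘ.M`. -/
def absList (xs : List ℕ) (M : Term) : Term := xs.foldr abs M

/-- The iterated application `M N₁ ⋯ Nₖ`. -/
def appList (M : Term) (Ns : List Term) : Term := Ns.foldl app M

/-- The identity `I = λx.x`. -/
def I : Term := lam (var 0)

end Term

open Term

/-- Beta-equivalence `M =β N`. -/
inductive BetaEq : Term → Term → Prop
  | beta (M N : Term) : BetaEq (app (lam M) N) (inst M N)
  | app {M M' N N' : Term} : BetaEq M M' → BetaEq N N' → BetaEq (app M N) (app M' N')
  | lam {M M' : Term} : BetaEq M M' → BetaEq (lam M) (lam M')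
  | refl (M : Term) : BetaEq M M
  | symm {M N : Term} : BetaEq M N → BetaEq N M
  | trans {M N P : Term} : BetaEq M N → BetaEq N P → BetaEq M P

/-- `M` is solvable: `(λx₁.⋯λxₘ.M) N₁ ⋯ Nₖ =β I` for some variables `xᵢ` and terms `Nⱼ`. -/
def Solvable (M : Term) : Prop :=
  ∃ (xs : List ℕ) (Ns : List Term), BetaEq (appList (absList xs M) Ns) I

/-! ### Contexts -/

/-- Contexts `C[-] ::= [-] | x | C[-] C'[-] | λx.C[-]`. -/
inductive Context : Type
  | hole : Context
  | var : ℕ → Context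
  | app : Context → Context → Context
  | abs : ℕ → Context → Context

/-- `C.plug M` is `C[M]`. A binder `λx` of `C` captures the free occurrences of `x` in `M`. -/
def Context.plug : Context → Term → Term
  | .hole, M => M
  | .var x, _ => Term.var x
  | .app C D, M => Term.app (C.plug M) (D.plug M)
  | .abs x C, M => Term.abs x (C.plug M)

/-! ### Lambda-theories -/

/-- Lambda-theories. -/
structure IsLambdaTheory (R : Term → Term → Prop) : Prop where
  equivalence : Equivalence R
  congr₁ : ∀ M N P, R M N → R (app M P) (app N P)
  congr₂ : ∀ M N P, R M N → R (app P M) (app P N)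
  xi : ∀ x M N, R M N → R (abs x M) (abs x N)
  beta : ∀ x M N, R (app (abs x M) N) (substVar x N M)

/-- Extensional lambda-theories. -/
structure IsExtensionalLambdaTheory (R : Term → Term → Prop) : Prop extends
    IsLambdaTheory R where
  eta : ∀ x M, ¬ FreeIn x M → R M (abs x (app M (var x)))

/-! ### Partial pseudo-metrics -/

section PPM

variable {X : Type*}

/-- Partial pseudo-metrics with values in `[0, ∞]`. The axiom
`p x y ≤ p x z + p z y - p z z` is stated without subtraction. -/
structure IsPPM (p : X → X → ℝ≥0∞) : Prop where
  self_le : ∀ x y, p x x ≤ p x y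
  symm : ∀ x y, p x y = p y x
  triangle : ∀ x y z, p x y + p z z ≤ p x z + p z y

/-- The preorder `x ≤_p y`. -/
def PLe (p : X → X → ℝ≥0∞) (x y : X) : Prop := p x y ≤ p x x

/-- The equivalence `x ≃_p y`. -/
def PEquiv (p : X → X → ℝ≥0∞) (x y : X) : Prop := PLe p x y ∧ PLe p y x

/-- The open ball of centre `x` and radius `ε`. -/
def pBall (p : X → X → ℝ≥0∞) (x : X) (ε : ℝ≥0) : Set X := {y | p y x < p x x + ε}

/-- The open sets of `p` are the unions of open balls. -/
def IsPOpen (p : X → X → ℝ≥0∞) (U : Set X) : Prop :=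
  ∃ B : Set (Set X), (∀ b ∈ B, ∃ (x : X) (ε : ℝ≥0), 0 < ε ∧ b = pBall p x ε) ∧ U = ⋃₀ B

/-- Continuity of `f : X → X` with respect to the topology of `p`. -/
def IsPContinuous (p : X → X → ℝ≥0∞) (f : X → X) : Prop :=
  ∀ U, IsPOpen p U → IsPOpen p (f ⁻¹' U)

/-- `x` is generic for `p`: it lies below every point. -/
def IsPGeneric (p : X → X → ℝ≥0∞) (x : X) : Prop := ∀ y, PLe p x y

/-- A point is generic for `p` iff the whole space is the only open set that can contain it. -/
theorem isPGeneric_iff {p : X → X → ℝ≥0∞} (hp : IsPPM p) (x : X) :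
    IsPGeneric p x ↔ ∀ U, IsPOpen p U → x ∈ U → U = Set.univ := by
  constructor
  · rintro hx U ⟨B, hB, rfl⟩ ⟨b, hb, hxb⟩
    obtain ⟨z, ε, hε, rfl⟩ := hB b hb
    refine Set.eq_univ_of_forall fun y => ⟨_, hb, ?_⟩
    have hlt : p x z < p z z + ε := hxb
    have hfin : p x x ≠ ⊤ := ((hp.self_le x z).trans_lt (hlt.trans_le le_top)).ne
    have h1 : p y z + p x x ≤ p x x + p x z :=
      (hp.triangle y z x).trans (by gcongr; rw [hp.symm]; exact hx y)
    rw [add_comm (p x x)] at h1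
    exact ((ENNReal.add_le_add_iff_right hfin).1 h1).trans_lt hlt
  · intro h y
    by_cases hfin : p x x = ⊤
    · simp [PLe, hfin]
    · refine ENNReal.le_of_forall_pos_le_add fun ε hε _ => ?_
      have hmem : x ∈ pBall p x ε :=
        ENNReal.lt_add_right hfin (by exact_mod_cast hε.ne')
      have hU := h (pBall p x ε) ⟨{pBall p x ε}, by
        rintro b rfl; exact ⟨x, ε, hε, rfl⟩, by simp⟩ hmem
      have hy : y ∈ pBall p x ε := hU ▸ Set.mem_univ y
      rw [hp.symm]
      exact le_of_lt hy

end PPM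

/-- Extensional lambda-PPMs. -/
structure IsExtensionalLambdaPPM (p : Term → Term → ℝ≥0∞) : Prop where
  isPPM : IsPPM p
  theory : IsExtensionalLambdaTheory (PEquiv p)
  continuous : ∀ C : Context, IsPContinuous p C.plug

/-- `p` is sensible: all unsolvable terms are generic and no solvable term is. -/
def IsSensible (p : Term → Term → ℝ≥0∞) : Prop :=
  (∀ M, ¬ Solvable M → IsPGeneric p M) ∧ (∀ M, Solvable M → ¬ IsPGeneric p M)

/-- The contextual partial metric for a sequence `C₀, C₁, …` of contexts: the sum of `2⁻ⁿ` over
all `n` such that `Cₙ[M]` is unsolvable or `Cₙ[N]` is unsolvable. -/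
noncomputable def pCtx (C : ℕ → Context) (M N : Term) : ℝ≥0∞ :=
  ∑' n : {n : ℕ // ¬ Solvable ((C n).plug M) ∨ ¬ Solvable ((C n).plug N)}, 1 / 2 ^ (n : ℕ)

end LambdaCalc

namespace LambdaCalc

open Term

/-! ### Renaming and substitution -/

namespace Term

/-! Since every weight `2⁻ⁿ` is positive and their sum is finite, `M ≤ N` for `pCtx` means that
every context making `M` solvable makes `N` solvable (`pLe_pCtx_iff_forall`). So `≃` is
observational equivalence, a congruence because contexts compose.

What remains, namely β, η and genericity, comes from a relational model (non-idempotent intersection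
types). Its denotations `den` are monotone under contexts, invariant under β and η, and nonempty
exactly at the solvable terms (`solvable_iff_typable`). Hence `den M ≤ den N` implies `M ≤ N`; an
unsolvable term denotes `∅` and so lies below every term. For adequacy, each head step lowers the
size of a derivation by exactly one, so a typable term reaches a head normal form, and those are
solvable. Conversely, typability passes from `I` back through β, application and abstraction.

Continuity is a tail estimate: up to a small error only finitely many contexts count, and a small
enough ball preserves solvability in all of them. -/

theorem rename_congr {ρ ρ' : ℕ → ℕ} {M : Term} (h : ∀ x, FreeIn x M → ρ x = ρ' x) :
    rename ρ M = rename ρ' M := by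
  induction M generalizing ρ ρ' with
  | var i => simp [rename, h i rfl]
  | app M N ihM ihN =>
    simp only [rename]
    rw [ihM fun x hx => h x (Or.inl hx), ihN fun x hx => h x (Or.inr hx)]
  | lam M ih =>
    simp only [rename]
    rw [ih]
    rintro (_ | x) hx
    · rfl
    · simp [upRen, h x hx]

theorem rename_id (M : Term) : rename (fun i => i) M = M := by
  induction M with
  | var i => rfl
  | app M N ihM ihN => simp [rename, ihM, ihN]
  | lam M ih =>
    have : upRen (fun i => i) = fun i => i := by funext i; cases i <;> rfl
    simp [rename, this, ih]

theorem rename_rename (ρ ρ' : ℕ → ℕ) (M : Term) :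
    rename ρ (rename ρ' M) = rename (fun i => ρ (ρ' i)) M := by
  induction M generalizing ρ ρ' with
  | var i => rfl
  | app M N ihM ihN => simp [rename, ihM, ihN]
  | lam M ih =>
    have : (fun i => upRen ρ (upRen ρ' i)) = upRen fun i => ρ (ρ' i) := by
      funext i; cases i <;> rfl
    simp [rename, this, ih]

theorem subst_rename (σ : ℕ → Term) (ρ : ℕ → ℕ) (M : Term) :
    subst σ (rename ρ M) = subst (fun i => σ (ρ i)) M := by
  induction M generalizing σ ρ with
  | var i => rfl
  | app M N ihM ihN => simp [rename, subst, ihM, ihN]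
  | lam M ih =>
    have : (fun i => up σ (upRen ρ i)) = up fun i => σ (ρ i) := by
      funext i; cases i <;> rfl
    simp [rename, subst, this, ih]

theorem rename_subst (ρ : ℕ → ℕ) (σ : ℕ → Term) (M : Term) :
    rename ρ (subst σ M) = subst (fun i => rename ρ (σ i)) M := by
  induction M generalizing σ ρ with
  | var i => rfl
  | app M N ihM ihN => simp [rename, subst, ihM, ihN]
  | lam M ih =>
    have : (fun i => rename (upRen ρ) (up σ i)) = up fun i => rename ρ (σ i) := by
      funext i
      cases i with
      | zero => rfl
      | succ i => simp [up, rename_rename, upRen]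
    simp [rename, subst, this, ih]

theorem subst_subst (τ σ : ℕ → Term) (M : Term) :
    subst τ (subst σ M) = subst (fun i => subst τ (σ i)) M := by
  induction M generalizing σ τ with
  | var i => rfl
  | app M N ihM ihN => simp [subst, ihM, ihN]
  | lam M ih =>
    have : (fun i => subst (up τ) (up σ i)) = up fun i => subst τ (σ i) := by
      funext i
      cases i with
      | zero => rfl
      | succ i => simp [up, subst_rename, rename_subst]
    simp [subst, this, ih]

theorem subst_var (M : Term) : subst var M = M := by
  induction M with
  | var i => rfl
  | app M N ihM ihN => simp [subst, ihM, ihN]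
  | lam M ih =>
    have : up var = var := by funext i; cases i <;> rfl
    simp [subst, this, ih]

/-- Extension of a substitution `σ` by a value `N` at the index `0`. -/
def scons (N : Term) (σ : ℕ → Term) : ℕ → Term
  | 0 => N
  | i + 1 => σ i

theorem inst_eq (M N : Term) : inst M N = subst (scons N var) M := by
  unfold inst
  congr 1
  funext i
  cases i <;> rfl

theorem inst_subst_up (σ : ℕ → Term) (M N : Term) :
    inst (subst (up σ) M) N = subst (scons N σ) M := by
  rw [inst_eq, subst_subst]
  congr 1
  funext i
  cases i with
  | zero => rfl
  | succ i => simp [up, subst_rename, scons, subst_var]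

theorem rename_inst (ρ : ℕ → ℕ) (M N : Term) :
    rename ρ (inst M N) = inst (rename (upRen ρ) M) (rename ρ N) := by
  rw [inst_eq, inst_eq, rename_subst, subst_rename]
  congr 1
  funext i
  cases i <;> rfl

theorem inst_abs (x : ℕ) (M N : Term) :
    inst (rename (fun i => if i = x then 0 else i + 1) M) N = substVar x N M := by
  rw [inst_eq, subst_rename, substVar]
  congr 1
  funext i
  by_cases h : i = x <;> simp [h, scons]

theorem exists_freeIn_lt (M : Term) : ∃ b, ∀ x, FreeIn x M → x < b := by
  induction M with
  | var i => exact ⟨i + 1, fun x hx => by simp only [FreeIn] at hx; omega⟩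
  | app M N ihM ihN =>
    obtain ⟨b, hb⟩ := ihM
    obtain ⟨c, hc⟩ := ihN
    refine ⟨max b c, fun x hx => ?_⟩
    rcases hx with hx | hx
    · exact lt_max_of_lt_left (hb x hx)
    · exact lt_max_of_lt_right (hc x hx)
  | lam M ih =>
    obtain ⟨b, hb⟩ := ih
    exact ⟨b, fun x hx => (Nat.lt_succ_self x).trans (hb _ hx)⟩

theorem abs_app_var_eq {x : ℕ} {M : Term} (h : ¬ FreeIn x M) :
    abs x (app M (var x)) = lam (app (rename Nat.succ M) (var 0)) := by
  simp only [abs, rename, if_true]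
  rw [rename_congr (ρ' := Nat.succ)]
  intro y hy
  rw [if_neg]
  rintro rfl
  exact h hy

end Term

/-! ### Contexts -/

namespace Context

/-- Composition of contexts. -/
def comp : Context → Context → Context
  | hole, D => D
  | var x, _ => var x
  | app C₁ C₂, D => app (C₁.comp D) (C₂.comp D)
  | abs x C, D => abs x (C.comp D)

theorem plug_comp (C D : Context) (M : Term) : (C.comp D).plug M = C.plug (D.plug M) := by
  induction C with
  | hole => rfl
  | var x => rfl
  | app C₁ C₂ h₁ h₂ => simp [comp, plug, h₁, h₂]
  | abs x C h => simp [comp, plug, h]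

/-- Context binders are named, so an index bound in `M` must be given a fresh name; the arbitrary
`ρ` records the names chosen so far. -/
theorem exists_plug_eq_rename (ρ : ℕ → ℕ) (M : Term) :
    ∃ C : Context, ∀ N, C.plug N = rename ρ M := by
  induction M generalizing ρ with
  | var i => exact ⟨var (ρ i), fun _ => rfl⟩
  | app M N ihM ihN =>
    obtain ⟨C, hC⟩ := ihM ρ
    obtain ⟨D, hD⟩ := ihN ρ
    exact ⟨app C D, fun P => by simp [plug, rename, hC, hD]⟩
  | lam M ih =>
    obtain ⟨b, hb⟩ := exists_freeIn_lt (rename ρ (Term.lam M))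
    obtain ⟨c, hc⟩ := exists_freeIn_lt M
    -- Freshness for the images of the free variables ensures that `abs x` binds only what came from
    -- index `0`.
    obtain ⟨x, hx⟩ : ∃ x, ∀ i < c, ρ i ≠ x := by
      obtain ⟨x, hx⟩ := Infinite.exists_notMem_finset ((Finset.range c).image ρ)
      exact ⟨x, fun i hi h => hx (Finset.mem_image.2 ⟨i, Finset.mem_range.2 hi, h⟩)⟩
    obtain ⟨C, hC⟩ := ih fun i => Nat.casesOn i x ρ
    refine ⟨abs x C, fun N => ?_⟩
    simp only [plug, hC, Term.abs, rename, rename_rename]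
    congr 1
    refine rename_congr fun i hi => ?_
    cases i with
    | zero => simp [upRen]
    | succ i => simp [upRen, hx i ((Nat.lt_succ_self i).trans (hc _ hi))]

theorem exists_plug_eq (M : Term) : ∃ C : Context, ∀ N, C.plug N = M := by
  simpa [rename_id] using exists_plug_eq_rename (fun i => i) M

end Context

/-! ### Beta-equivalence and head normal forms -/

theorem BetaEq.rename {M N : Term} (h : BetaEq M N) (ρ : ℕ → ℕ) :
    BetaEq (M.rename ρ) (N.rename ρ) := by
  induction h generalizing ρ with
  | beta M N =>
    rw [rename_inst]
    exact .beta _ _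
  | app _ _ h₁ h₂ => exact .app (h₁ ρ) (h₂ ρ)
  | lam _ h => exact .lam (h _)
  | refl M => exact .refl _
  | symm _ h => exact .symm (h ρ)
  | trans _ _ h₁ h₂ => exact .trans (h₁ ρ) (h₂ ρ)

theorem BetaEq.abs {M N : Term} (h : BetaEq M N) (x : ℕ) : BetaEq (M.abs x) (N.abs x) :=
  .lam (h.rename _)

theorem BetaEq.appList {M N : Term} (h : BetaEq M N) (Ps : List Term) :
    BetaEq (M.appList Ps) (N.appList Ps) := by
  induction Ps generalizing M N with
  | nil => exact h
  | cons P Ps ih => exact ih (.app h (.refl P))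

/-- One step of head reduction. -/
inductive HeadStep : Term → Term → Prop
  | beta (M N : Term) : HeadStep (app (lam M) N) (inst M N)
  | app {M M' : Term} (N : Term) : HeadStep M M' → HeadStep (app M N) (app M' N)
  | lam {M M' : Term} : HeadStep M M' → HeadStep (lam M) (lam M')

theorem HeadStep.betaEq {M M' : Term} (h : HeadStep M M') : BetaEq M M' := by
  induction h with
  | beta M N => exact .beta M N
  | app N _ ih => exact .app ih (.refl N)
  | lam _ ih => exact .lam ih

/-- Variables applied to any number of arguments. -/
inductive Neutral : Term → Prop
  | var (i : ℕ) : Neutral (var i)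
  | app {M : Term} (N : Term) : Neutral M → Neutral (app M N)

/-- Head normal forms. -/
inductive IsHNF : Term → Prop
  | neutral {M : Term} : Neutral M → IsHNF M
  | lam {M : Term} : IsHNF M → IsHNF (lam M)

theorem isHNF_or_headStep (M : Term) : IsHNF M ∨ ∃ M', HeadStep M M' := by
  induction M with
  | var i => exact .inl (.neutral (.var i))
  | app M N ih _ =>
    rcases ih with (h | h) | ⟨M', h⟩
    · exact .inl (.neutral (.app N h))
    · exact .inr ⟨_, .beta _ N⟩
    · exact .inr ⟨_, .app N h⟩
  | lam M ih =>
    rcases ih with h | ⟨M', h⟩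
    · exact .inl (.lam h)
    · exact .inr ⟨_, .lam h⟩

/-! ### Solvability of head normal forms -/

/-- The closed term `λy₁⋯yₖ.I`. -/
def eraser : ℕ → Term
  | 0 => I
  | k + 1 => lam (eraser k)

theorem subst_eraser (σ : ℕ → Term) (k : ℕ) : subst σ (eraser k) = eraser k := by
  induction k generalizing σ with
  | zero => rfl
  | succ k ih => simp [eraser, subst, ih]

/-- Here `x` is the head variable and `k` its number of arguments, each swallowed by one abstraction
of the eraser. The surplus `j` makes the induction go through. -/
theorem Neutral.exists_subst_betaEq {M : Term} (h : Neutral M) :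
    ∃ x k, ∀ (σ : ℕ → Term) (j : ℕ), σ x = eraser (j + k) → BetaEq (subst σ M) (eraser j) := by
  induction h with
  | var i =>
    refine ⟨i, 0, fun σ j h => ?_⟩
    simp only [subst, h]
    exact .refl _
  | app N _ ih =>
    obtain ⟨x, k, ih⟩ := ih
    refine ⟨x, k + 1, fun σ j h => ?_⟩
    have h₁ := ih σ (j + 1) (by rw [h]; congr 1; omega)
    have h₂ := BetaEq.beta (eraser j) (subst σ N)
    rw [inst_eq, subst_eraser] at h₂
    exact .trans (.app h₁ (.refl _)) h₂

theorem IsHNF.exists_subst_betaEq {M : Term} (h : IsHNF M) :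
    ∃ x k, ∀ σ : ℕ → Term, σ x = eraser k →
      ∃ Ns : List Term, BetaEq (appList (subst σ M) Ns) I := by
  induction h with
  | neutral h =>
    obtain ⟨x, k, h⟩ := h.exists_subst_betaEq
    exact ⟨x, k, fun σ hσ => ⟨[], h σ 0 (by simpa using hσ)⟩⟩
  | @lam M _ ih =>
    obtain ⟨x, k, ih⟩ := ih
    have key (σ : ℕ → Term) (N : Term) (hN : scons N σ x = eraser k) :
        ∃ Ns : List Term, BetaEq (appList (subst σ (Term.lam M)) Ns) I := by
      obtain ⟨Ns, h⟩ := ih _ hN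
      have hb := BetaEq.beta (subst (up σ) M) N
      rw [inst_subst_up] at hb
      exact ⟨N :: Ns, .trans (hb.appList Ns) h⟩
    cases x with
    -- The head variable is bound by this abstraction, so the eraser is passed as an argument and
    -- the returned pair is a dummy. In the other case the argument `I` is the dummy.
    | zero => exact ⟨0, 0, fun σ _ => key σ (eraser k) rfl⟩
    | succ x => exact ⟨x, k, fun σ hσ => key σ I hσ⟩

theorem Solvable.of_betaEq_isHNF {M H : Term} (h : BetaEq M H) (hH : IsHNF H) : Solvable M := by
  obtain ⟨x, k, hx⟩ := hH.exists_subst_betaEq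
  obtain ⟨Ns, hNs⟩ := hx (fun i => if i = x then eraser k else var i) (by simp)
  refine ⟨[x], eraser k :: Ns, .trans (BetaEq.appList ?_ Ns) hNs⟩
  have hb := BetaEq.beta (rename (fun i => if i = x then 0 else i + 1) H) (eraser k)
  rw [inst_abs] at hb
  exact .trans (.app (h.abs x) (.refl _)) hb

/-! ### A relational model

Types are natural numbers, where `arr` is a bijection from pairs of a finite multiset of types and
a type to types. A *judgement* `(n, Γ)` consists of the number `n` of applications in a derivation
and of the multiset `Γ` of all assumptions (pairs of a variable and a type) that it uses. -/

open scoped Pointwise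

/-- The arrow type constructor. -/
def arr : Multiset ℕ × ℕ ≃ ℕ := Denumerable.eqv (Multiset ℕ × ℕ)

/-- Sizes of derivations with multisets of assumptions. -/
abbrev Judgement : Type := ℕ × Multiset (ℕ × ℕ)

namespace Judgement

/-- Renaming of the variables in the assumptions. -/
def ren (ρ : ℕ → ℕ) : Judgement →+ Judgement :=
  (AddMonoidHom.id ℕ).prodMap (Multiset.mapAddMonoidHom (Prod.map ρ id))

/-- Adding assumptions on a new variable `0`. -/
def lift (s : Multiset ℕ) (w : Judgement) : Judgement :=
  (0, s.map (Prod.mk 0)) + ren Nat.succ w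

theorem ren_mk (ρ : ℕ → ℕ) (w : Judgement) :
    ren ρ w = (w.1, w.2.map (Prod.map ρ id)) := rfl

/-- With `lift_injective`: assumptions under a binder split uniquely into those on variable `0` and
the others. -/
theorem exists_eq_lift (w : Judgement) : ∃ s v, w = lift s v := by
  obtain ⟨n, Γ⟩ := w
  induction Γ using Multiset.induction with
  | empty => exact ⟨0, (n, 0), by simp [lift, ren_mk]⟩
  | cons p Γ ih =>
    obtain ⟨s, ⟨k, Δ⟩, h⟩ := ih
    obtain ⟨i, a⟩ := p
    simp only [lift, ren_mk, Prod.mk_add_mk, zero_add, Prod.mk.injEq] at h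
    obtain ⟨rfl, rfl⟩ := h
    cases i with
    | zero => exact ⟨a ::ₘ s, (n, Δ), by simp [lift, ren_mk]⟩
    | succ i => exact ⟨s, (n, (i, a) ::ₘ Δ), by simp [lift, ren_mk]⟩

theorem lift_injective {s t : Multiset ℕ} {v w : Judgement} (h : lift s v = lift t w) :
    s = t ∧ v = w := by
  obtain ⟨n, Γ⟩ := v
  obtain ⟨m, Δ⟩ := w
  simp only [lift, ren_mk, Prod.mk_add_mk, zero_add, Prod.mk.injEq] at h
  obtain ⟨rfl, h⟩ := h
  constructor
  -- A `bind` reads off the types assumed for variable `0`; in the second half a filter discards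
  -- these assumptions.
  · have h₁ (u : Multiset ℕ) : (u.bind fun a => {a}) = u :=
      (Multiset.bind_singleton u id).trans u.map_id
    simpa [Multiset.bind_map, h₁] using
      congrArg (Multiset.bind · fun p => if p.1 = 0 then {p.2} else 0) h
  · have h₁ : Function.Injective (Prod.map Nat.succ (id : ℕ → ℕ)) :=
      Nat.succ_injective.prodMap Function.injective_id
    refine congrArg _ (Multiset.map_injective h₁ ?_)
    have h₂ := congrArg (Multiset.filter fun p => p.1 ≠ 0) h
    simpa [Multiset.filter_map, Function.comp_def] using h₂

theorem lift_size_add (n : ℕ) (s : Multiset ℕ) (w : Judgement) :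
    lift s ((n, 0) + w) = (n, 0) + lift s w := by
  simp only [lift, map_add]
  rw [add_left_comm]
  simp [ren_mk]

theorem ren_upRen_lift (ρ : ℕ → ℕ) (s : Multiset ℕ) (w : Judgement) :
    ren (upRen ρ) (lift s w) = lift s (ren ρ w) := by
  simp [lift, ren_mk, upRen, Function.comp_def, Prod.map]

/-- Judgements obtained from judgements in `S` on replacing each assumption `p` by a judgement
in `R p`. -/
def bindHom (R : ℕ × ℕ → Set Judgement) : Set Judgement →+ Set Judgement where
  toFun S := ⋃ u ∈ S, {(u.1, 0)} + (u.2.map R).sum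
  map_zero' := by
    rw [← Set.singleton_zero]
    simp
  map_add' S T := by
    have key (u v : Judgement) : ({((u + v).1, 0)} + ((u + v).2.map R).sum : Set Judgement) =
        ({(u.1, 0)} + (u.2.map R).sum) + ({(v.1, 0)} + (v.2.map R).sum) := by
      rw [add_add_add_comm, Set.singleton_add_singleton]
      simp
    ext w
    simp only [Set.mem_iUnion, exists_prop, Set.mem_add (s := ⋃ u ∈ S, _)]
    constructor
    · rintro ⟨_, ⟨u, hu, v, hv, rfl⟩, hw⟩
      dsimp only at hw
      rw [key] at hw
      obtain ⟨x, hx, y, hy, rfl⟩ := hw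
      exact ⟨x, ⟨u, hu, hx⟩, y, ⟨v, hv, hy⟩, rfl⟩
    · rintro ⟨x, ⟨u, hu, hx⟩, y, ⟨v, hv, hy⟩, rfl⟩
      refine ⟨u + v, Set.add_mem_add hu hv, ?_⟩
      rw [key]
      exact Set.add_mem_add hx hy

theorem mem_bind {R : ℕ × ℕ → Set Judgement} {S : Set Judgement} {w : Judgement} :
    w ∈ bindHom R S ↔ ∃ u ∈ S, ∃ v ∈ (u.2.map R).sum, (u.1, 0) + v = w := by
  simp [bindHom]

theorem bind_iUnion {ι : Sort*} (R : ℕ × ℕ → Set Judgement) (S : ι → Set Judgement) :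
    bindHom R (⋃ i, S i) = ⋃ i, bindHom R (S i) := by
  ext w
  simp only [mem_bind, Set.mem_iUnion]
  exact ⟨fun ⟨u, ⟨i, hu⟩, h⟩ => ⟨i, u, hu, h⟩, fun ⟨i, u, hu, h⟩ => ⟨u, ⟨i, hu⟩, h⟩⟩

theorem bind_singleton_size (R : ℕ × ℕ → Set Judgement) (n : ℕ) :
    bindHom R {(n, 0)} = {(n, 0)} := by
  simp [bindHom]

theorem sum_singleton (Γ : Multiset (ℕ × ℕ)) :
    (Γ.map fun p => ({(0, {p})} : Set Judgement)).sum = {(0, Γ)} := by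
  induction Γ using Multiset.induction with
  | empty => rfl
  | cons p Γ ih => simp [ih, Multiset.singleton_add]

end Judgement

/-! ### The interpretation under substitution, β, η and head reduction -/

open Judgement

/-- The interpretation of a term: `w ∈ sem M a` if there is a derivation of type `a` for `M` with
the size and the assumptions `w`. -/
def sem : Term → ℕ → Set Judgement
  | var i => fun a => {(0, {(i, a)})}
  | app M N => fun a => ⋃ s : Multiset ℕ, {(1, 0)} + (sem M (arr (s, a)) + (s.map (sem N)).sum)
  | lam M => fun a => {w | lift (arr.symm a).1 w ∈ sem M (arr.symm a).2}

theorem mem_sem_lam_arr {M : Term} {s : Multiset ℕ} {a : ℕ} {w : Judgement} :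
    w ∈ sem (lam M) (arr (s, a)) ↔ lift s w ∈ sem M a := by
  simp [sem]

theorem sem_rename (ρ : ℕ → ℕ) (M : Term) (a : ℕ) :
    sem (rename ρ M) a = ren ρ '' sem M a := by
  induction M generalizing ρ a with
  | var i => simp [rename, sem, ren_mk]
  | app M N ihM ihN =>
    simp only [rename, sem, ihM, Set.image_iUnion, Set.image_add, Set.image_multiset_sum,
      Multiset.map_map, Function.comp_def]
    rw [show sem (rename ρ N) = fun b => ren ρ '' sem N b from funext (ihN ρ)]
    simp [ren_mk]
  | lam M ih =>
    obtain ⟨⟨s, b⟩, rfl⟩ := arr.surjective a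
    ext w
    simp only [rename, mem_sem_lam_arr, ih, Set.mem_image]
    constructor
    · rintro ⟨u, hu, h⟩
      obtain ⟨t, v, rfl⟩ := exists_eq_lift u
      rw [ren_upRen_lift] at h
      obtain ⟨rfl, rfl⟩ := lift_injective h
      exact ⟨v, hu, rfl⟩
    · rintro ⟨v, hv, rfl⟩
      exact ⟨_, hv, ren_upRen_lift ρ s v⟩

theorem sum_map_lift (R : ℕ × ℕ → Set Judgement) (t : Multiset ℕ) (v : Judgement) :
    ((lift t v).2.map R).sum =
      (t.map fun b => R (0, b)).sum + (v.2.map fun p => R (p.1 + 1, p.2)).sum := by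
  simp [lift, ren_mk, Prod.map]

/-- Each assumption `(x, b)` of a derivation for `M` is replaced by its own derivation of type `b`
for `σ x`, and sizes add up. Additivity of `bindHom` settles applications. -/
theorem sem_subst (σ : ℕ → Term) (M : Term) (a : ℕ) :
    sem (subst σ M) a = bindHom (fun p => sem (σ p.1) p.2) (sem M a) := by
  induction M generalizing σ a with
  | var i =>
    have : ((0, 0) : Judgement) = 0 := rfl
    simp [subst, sem, bindHom, this]
  | app M N ihM ihN =>
    simp only [subst, sem, ihM, bind_iUnion, map_add, bind_singleton_size, map_multiset_sum,
      Multiset.map_map, Function.comp_def]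
    rw [show sem (subst σ N) = fun b => bindHom (fun p => sem (σ p.1) p.2) (sem N b) from
      funext (ihN σ)]
  | lam M ih =>
    obtain ⟨⟨s, b⟩, rfl⟩ := arr.surjective a
    have key (t : Multiset ℕ) (v : Judgement) :
        ((lift t v).2.map fun p => sem (up σ p.1) p.2).sum =
          lift t '' (v.2.map fun p => sem (σ p.1) p.2).sum := by
      have h₁ : (t.map fun b => ({(0, {(0, b)})} : Set Judgement)).sum =
          {(0, t.map (Prod.mk 0))} := by
        rw [← sum_singleton, Multiset.map_map]
        rfl
      rw [sum_map_lift]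
      simp only [up, sem, sem_rename, h₁]
      have h₂ := Set.image_multiset_sum (ren Nat.succ) (v.2.map fun p => sem (σ p.1) p.2)
      rw [Multiset.map_map] at h₂
      refine (congrArg _ h₂.symm).trans ?_
      rw [Set.singleton_add, Set.image_image]
      rfl
    ext w
    simp only [subst, mem_sem_lam_arr, ih, mem_bind]
    constructor
    · rintro ⟨u, hu, x, hx, h⟩
      obtain ⟨t, v, rfl⟩ := exists_eq_lift u
      rw [key] at hx
      obtain ⟨x, hx, rfl⟩ := hx
      have h₀ : (lift t v).1 = v.1 := by simp [lift, ren_mk]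
      rw [h₀, ← lift_size_add] at h
      obtain ⟨rfl, rfl⟩ := lift_injective h
      exact ⟨v, hu, x, hx, rfl⟩
    · rintro ⟨v, hv, x, hx, rfl⟩
      refine ⟨_, hv, lift s x, ?_, ?_⟩
      · rw [key]
        exact ⟨x, hx, rfl⟩
      · rw [lift_size_add]
        simp [lift, ren_mk]

/-- The argument is typed once for each assumption on the bound variable, so contraction neither
copies nor drops subderivations; only the application node of the redex disappears. -/
theorem sem_beta (M N : Term) (a : ℕ) :
    sem (app (lam M) N) a = {(1, 0)} + sem (inst M N) a := by
  have key (t : Multiset ℕ) (v : Judgement) :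
      ((lift t v).2.map fun p => sem (scons N var p.1) p.2).sum =
        {(0, v.2)} + (t.map (sem N)).sum := by
    rw [sum_map_lift, add_comm]
    simp only [scons, sem, Prod.mk.eta, sum_singleton]
  have h₀ (t : Multiset ℕ) (v : Judgement) : (lift t v).1 = v.1 := by simp [lift, ren_mk]
  rw [inst_eq, sem_subst]
  simp only [sem, ← Set.add_iUnion]
  congr 1
  ext w
  simp only [mem_bind, Set.mem_iUnion, Set.mem_add, Equiv.symm_apply_apply, Set.mem_ofPred_eq]
  constructor
  · rintro ⟨s, v, hv, x, hx, rfl⟩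
    refine ⟨_, hv, (0, v.2) + x, ?_, ?_⟩
    · rw [key]
      exact Set.add_mem_add rfl hx
    · rw [h₀, ← add_assoc]
      simp
  · rintro ⟨u, hu, x, hx, rfl⟩
    obtain ⟨s, v, rfl⟩ := exists_eq_lift u
    rw [key] at hx
    obtain ⟨_, rfl, x, hx, rfl⟩ := hx
    refine ⟨s, v, hu, x, hx, ?_⟩
    rw [h₀, ← add_assoc]
    simp

/-- Extensionality comes from the surjectivity of `arr`: every type is an arrow type. -/
theorem sem_eta {x : ℕ} {M : Term} (h : ¬ FreeIn x M) (a : ℕ) :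
    sem (abs x (app M (var x))) a = {(1, 0)} + sem M a := by
  obtain ⟨⟨s, b⟩, rfl⟩ := arr.surjective a
  have h₁ (t : Multiset ℕ) : (t.map (sem (var 0))).sum = {(0, t.map (Prod.mk 0))} := by
    rw [← sum_singleton, Multiset.map_map]
    rfl
  rw [abs_app_var_eq h]
  ext w
  rw [mem_sem_lam_arr, sem]
  simp only [h₁, sem_rename, Set.mem_iUnion, Set.singleton_add, Set.add_singleton,
    Set.mem_image, exists_exists_and_eq_and]
  constructor
  · rintro ⟨t, v, hv, h⟩
    rw [add_comm (ren _ v)] at h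
    change (1, 0) + lift t v = _ at h
    rw [← lift_size_add] at h
    obtain ⟨rfl, rfl⟩ := lift_injective h
    exact ⟨v, hv, rfl⟩
  · rintro ⟨v, hv, rfl⟩
    refine ⟨s, v, hv, ?_⟩
    rw [add_comm (ren _ v), lift_size_add]
    rfl

/-- The loss is exactly one because a head redex never lies inside an argument, which may be typed
any number of times. -/
theorem HeadStep.sem_eq {M M' : Term} (h : HeadStep M M') (a : ℕ) :
    sem M a = {(1, 0)} + sem M' a := by
  induction h generalizing a with
  | beta M N => exact sem_beta M N a
  | app N _ ih => simp only [sem, ih, Set.add_iUnion, add_assoc]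
  | @lam M M' _ ih =>
    ext w
    obtain ⟨⟨s, b⟩, rfl⟩ := arr.surjective a
    simp only [mem_sem_lam_arr, ih, Set.singleton_add, Set.mem_image]
    constructor
    · rintro ⟨u, hu, h⟩
      obtain ⟨t, v, rfl⟩ := exists_eq_lift u
      rw [← lift_size_add] at h
      obtain ⟨rfl, rfl⟩ := lift_injective h
      exact ⟨v, hu, rfl⟩
    · rintro ⟨v, hv, rfl⟩
      exact ⟨_, hv, (lift_size_add 1 s v).symm⟩

/-! ### Denotations and solvability -/

/-- The interpretation of a term, without the sizes of derivations. -/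
def den (M : Term) (a : ℕ) : Set (Multiset (ℕ × ℕ)) :=
  AddMonoidHom.snd ℕ (Multiset (ℕ × ℕ)) '' sem M a

theorem den_eq_of_sem_eq {M N : Term} (h : ∀ a, sem M a = {(1, 0)} + sem N a) : den M = den N := by
  funext a
  simp [den, h, Set.image_image]

theorem den_app (M N : Term) (a : ℕ) :
    den (app M N) a = ⋃ s : Multiset ℕ, den M (arr (s, a)) + (s.map (den N)).sum := by
  simp only [den, sem, Set.image_iUnion, Set.image_add, Set.image_multiset_sum, Multiset.map_map,
    Function.comp_def]
  refine Set.iUnion_congr fun s => ?_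
  simp only [Set.image_singleton, AddMonoidHom.coe_snd, Set.singleton_zero, zero_add]
  rfl

theorem mem_den_lam {M : Term} {a : ℕ} {Γ : Multiset (ℕ × ℕ)} :
    Γ ∈ den (lam M) a ↔ (lift (arr.symm a).1 (0, Γ)).2 ∈ den M (arr.symm a).2 := by
  constructor
  · rintro ⟨w, hw, rfl⟩
    exact ⟨_, hw, rfl⟩
  · rintro ⟨⟨n, Δ⟩, h, rfl⟩
    refine ⟨(n, Γ), ?_, rfl⟩
    simpa [sem, lift, ren_mk] using h

theorem den_rename (ρ : ℕ → ℕ) (M : Term) (a : ℕ) :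
    den (rename ρ M) a = Multiset.map (Prod.map ρ id) '' den M a := by
  simp only [den, sem_rename, Set.image_image]
  rfl

theorem den_app_mono {M M' N N' : Term} (hM : den M ≤ den M') (hN : den N ≤ den N') :
    den (app M N) ≤ den (app M' N') := fun a => by
  simp only [den_app]
  exact Set.iUnion_mono fun s =>
    Set.add_subset_add (hM _) (Set.multiset_sum_subset_multiset_sum _ _ _ fun b _ => hN b)

theorem den_lam_mono {M M' : Term} (h : den M ≤ den M') : den (lam M) ≤ den (lam M') :=
  fun _ _ hΓ => mem_den_lam.2 (h _ (mem_den_lam.1 hΓ))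

theorem den_abs_mono (x : ℕ) {M M' : Term} (h : den M ≤ den M') :
    den (abs x M) ≤ den (abs x M') :=
  den_lam_mono fun a => by
    simp only [den_rename]
    exact Set.image_mono (h a)

theorem den_plug_mono (C : Context) {M N : Term} (h : den M ≤ den N) :
    den (C.plug M) ≤ den (C.plug N) := by
  induction C with
  | hole => exact h
  | var x => exact le_rfl
  | app C D hC hD => exact den_app_mono hC hD
  | abs x C hC => exact den_abs_mono x hC

/-- Sizes must be forgotten here: a step inside an argument changes the size by an amount depending
on the derivation. -/
theorem BetaEq.den_eq {M N : Term} (h : BetaEq M N) : den M = den N := by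
  induction h with
  | beta M N => exact den_eq_of_sem_eq (sem_beta M N)
  | app _ _ h₁ h₂ => exact le_antisymm (den_app_mono h₁.le h₂.le) (den_app_mono h₁.ge h₂.ge)
  | lam _ h => exact le_antisymm (den_lam_mono h.le) (den_lam_mono h.ge)
  | refl M => rfl
  | symm _ h => exact h.symm
  | trans _ _ h₁ h₂ => exact h₁.trans h₂

/-! ### Typability and solvability -/

/-- A term is typable if its interpretation is nonempty. -/
def Typable (M : Term) : Prop := ∃ a, (den M a).Nonempty

theorem Typable.mono {M N : Term} (hM : Typable M) (h : den M ≤ den N) : Typable N := by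
  obtain ⟨a, ha⟩ := hM
  exact ⟨a, ha.mono (h a)⟩

theorem Typable.of_app {M N : Term} (h : Typable (app M N)) : Typable M := by
  obtain ⟨a, Γ, h⟩ := h
  rw [den_app, Set.mem_iUnion] at h
  obtain ⟨s, Δ, hΔ, _⟩ := h
  exact ⟨_, Δ, hΔ⟩

theorem Typable.of_lam {M : Term} (h : Typable (lam M)) : Typable M := by
  obtain ⟨a, Γ, h⟩ := h
  exact ⟨_, _, mem_den_lam.1 h⟩

theorem Typable.of_abs {x : ℕ} {M : Term} (h : Typable (abs x M)) : Typable M := by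
  obtain ⟨a, h⟩ := Typable.of_lam h
  rw [den_rename] at h
  exact ⟨a, h.of_image⟩

theorem typable_I : Typable I := by
  refine ⟨arr ({0}, 0), 0, mem_den_lam.2 ⟨(0, {(0, 0)}), ?_, ?_⟩⟩ <;>
  simp [sem, lift, ren_mk]

/-- The size bounds the number of head steps. -/
theorem exists_isHNF_of_mem_sem {M : Term} {a n : ℕ} {Γ : Multiset (ℕ × ℕ)}
    (h : (n, Γ) ∈ sem M a) : ∃ H, IsHNF H ∧ BetaEq M H := by
  induction n generalizing M with
  | zero =>
    rcases isHNF_or_headStep M with hM | ⟨M', hM⟩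
    · exact ⟨M, hM, .refl M⟩
    · rw [hM.sem_eq, Set.singleton_add] at h
      obtain ⟨v, _, hv⟩ := h
      have := congrArg Prod.fst hv
      simp at this
  | succ n ih =>
    rcases isHNF_or_headStep M with hM | ⟨M', hM⟩
    · exact ⟨M, hM, .refl M⟩
    · rw [hM.sem_eq, Set.singleton_add] at h
      obtain ⟨⟨m, Δ⟩, hv, h⟩ := h
      simp only [Prod.mk_add_mk, zero_add, Prod.mk.injEq] at h
      obtain ⟨h, rfl⟩ := h
      obtain rfl : m = n := by omega
      obtain ⟨H, hH, hb⟩ := ih hv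
      exact ⟨H, hH, .trans hM.betaEq hb⟩

theorem solvable_iff_typable (M : Term) : Solvable M ↔ Typable M := by
  constructor
  · rintro ⟨xs, Ns, h⟩
    have h₁ : Typable (appList (absList xs M) Ns) := typable_I.mono h.den_eq.ge
    have h₂ : Typable (absList xs M) := by
      generalize absList xs M = P at h₁
      clear h
      induction Ns generalizing P with
      | nil => exact h₁
      | cons N Ns ih => exact (ih _ h₁).of_app
    clear h h₁
    induction xs with
    | nil => exact h₂
    | cons x xs ih => exact ih h₂.of_abs
  · rintro ⟨a, _, ⟨n, Γ⟩, h, rfl⟩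
    obtain ⟨H, hH, hb⟩ := exists_isHNF_of_mem_sem h
    exact .of_betaEq_isHNF hb hH

theorem Solvable.mono {M N : Term} (hM : Solvable M) (h : den M ≤ den N) : Solvable N := by
  rw [solvable_iff_typable] at *
  exact hM.mono h

/-- The genericity lemma. -/
theorem Solvable.plug_of_not_solvable {M : Term} (hM : ¬ Solvable M) {C : Context}
    (h : Solvable (C.plug M)) (N : Term) : Solvable (C.plug N) := by
  refine h.mono (den_plug_mono C fun a Γ hΓ => ?_)
  -- The denotation of an unsolvable term is empty.
  exact (hM ((solvable_iff_typable M).2 ⟨a, Γ, hΓ⟩)).elim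

/-- The term `Ω` head-reduces to itself, so a derivation of it would yield ever smaller ones. -/
theorem exists_not_solvable : ∃ M, ¬ Solvable M := by
  let ω := lam (app (var 0) (var 0))
  refine ⟨app ω ω, fun h => ?_⟩
  obtain ⟨a, _, ⟨n, Γ⟩, h, -⟩ := (solvable_iff_typable _).1 h
  have hs : sem (app ω ω) a = {(1, 0)} + sem (app ω ω) a := sem_beta _ _ a
  induction n with
  | zero =>
    rw [hs, Set.singleton_add] at h
    obtain ⟨v, _, hv⟩ := h
    have := congrArg Prod.fst hv
    simp at this
  | succ n ih =>
    rw [hs, Set.singleton_add] at h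
    obtain ⟨⟨m, Δ⟩, hv, h⟩ := h
    simp only [Prod.mk_add_mk, zero_add, Prod.mk.injEq] at h
    obtain ⟨h, rfl⟩ := h
    obtain rfl : m = n := by omega
    exact ih hv

/-! ### The weight of a set of natural numbers -/

/-- The sum of `2⁻ⁿ` over all `n ∈ A`. -/
noncomputable def weight (A : Set ℕ) : ℝ≥0∞ := ∑' n : A, 1 / 2 ^ (n : ℕ)

theorem weight_eq_tsum_indicator (A : Set ℕ) :
    weight A = ∑' n, A.indicator (fun n => (1 / 2 ^ n : ℝ≥0∞)) n :=
  tsum_subtype A fun n => (1 / 2 ^ n : ℝ≥0∞)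

theorem weight_mono {A B : Set ℕ} (h : A ⊆ B) : weight A ≤ weight B :=
  ENNReal.tsum_mono_subtype (fun n : ℕ => (1 / 2 ^ n : ℝ≥0∞)) h

theorem weight_ne_top (A : Set ℕ) : weight A ≠ ⊤ := by
  refine ne_top_of_le_ne_top ?_ (ENNReal.tsum_comp_le_tsum_of_injective
    Subtype.val_injective fun n : ℕ => (1 / 2 ^ n : ℝ≥0∞))
  simp only [one_div, ENNReal.inv_pow]
  rw [ENNReal.tsum_geometric, ENNReal.one_sub_inv_two, inv_inv]
  exact ENNReal.ofNat_ne_top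

theorem weight_union_add_le (A B D : Set ℕ) :
    weight (A ∪ B) + weight D ≤ weight (A ∪ D) + weight (D ∪ B) := by
  simp only [weight_eq_tsum_indicator, ← ENNReal.tsum_add]
  refine ENNReal.tsum_le_tsum fun n => ?_
  by_cases hA : n ∈ A <;> by_cases hB : n ∈ B <;> by_cases hD : n ∈ D <;>
    simp [Set.indicator, hA, hB, hD]

theorem weight_add_le {A B : Set ℕ} {n : ℕ} (h : A ⊆ B) (hn : n ∈ B) (hn' : n ∉ A) :
    weight A + 1 / 2 ^ n ≤ weight B := by
  have h₁ : weight {n} = 1 / 2 ^ n := by simp [weight]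
  have h₂ : weight (A ∪ {n}) = weight A + weight {n} :=
    ENNReal.summable.tsum_union_disjoint (f := fun n : ℕ => (1 / 2 ^ n : ℝ≥0∞))
      (Set.disjoint_singleton_right.2 hn') ENNReal.summable
  rw [← h₁, ← h₂]
  exact weight_mono (Set.union_subset h (Set.singleton_subset_iff.2 hn))

/-- A point of `B \ A` would add a positive mass to a finite weight. -/
theorem weight_union_le_iff {A B : Set ℕ} : weight (A ∪ B) ≤ weight A ↔ B ⊆ A := by
  refine ⟨fun h n hn => ?_, fun h => (Set.union_eq_self_of_subset_right h).symm ▸ le_rfl⟩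
  by_contra hn'
  have h₁ := (weight_add_le Set.subset_union_left (Set.mem_union_right A hn) hn').trans h
  exact (ENNReal.lt_add_right (weight_ne_top A) (by simp)).not_ge h₁

theorem exists_finset_weight_compl_lt {ε : ℝ≥0∞} (hε : 0 < ε) :
    ∃ s : Finset ℕ, weight {n | n ∉ s} < ε := by
  have h := ENNReal.tendsto_tsum_compl_atTop_zero (f := fun n : ℕ => (1 / 2 ^ n : ℝ≥0∞)) (by
    rw [← tsum_univ]
    exact weight_ne_top Set.univ)
  exact (h.eventually (gt_mem_nhds hε)).exists

theorem weight_le_add (A B : Set ℕ) : weight A ≤ weight B + weight (A \ B) := by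
  refine (weight_mono (Set.union_sdiff_self.symm ▸ Set.subset_union_right :
    A ⊆ B ∪ A \ B)).trans ?_
  exact ENNReal.tsum_union_le (fun n : ℕ => (1 / 2 ^ n : ℝ≥0∞)) _ _

/-! ### The contextual partial metric -/

/-- The indices of the contexts `D` in `C` for which `D[M]` is unsolvable. -/
def unsolvableIn (C : ℕ → Context) (M : Term) : Set ℕ := {n | ¬ Solvable ((C n).plug M)}

section

variable (C : ℕ → Context)

theorem pCtx_eq (M N : Term) :
    pCtx C M N = weight (unsolvableIn C M ∪ unsolvableIn C N) := rfl

theorem pCtx_self (M : Term) : pCtx C M M = weight (unsolvableIn C M) := by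
  rw [pCtx_eq, Set.union_self]

theorem isPPM_pCtx : IsPPM (pCtx C) where
  self_le M N := by
    rw [pCtx_self, pCtx_eq]
    exact weight_mono Set.subset_union_left
  symm M N := by rw [pCtx_eq, pCtx_eq, Set.union_comm]
  triangle M N P := by
    rw [pCtx_self]
    exact weight_union_add_le _ _ _

variable {C}

theorem pLe_pCtx_iff {M N : Term} : PLe (pCtx C) M N ↔ unsolvableIn C N ⊆ unsolvableIn C M := by
  rw [PLe, pCtx_self, pCtx_eq, weight_union_le_iff]

variable (hC : Function.Surjective C)
include hC

theorem pLe_pCtx_iff_forall {M N : Term} :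
    PLe (pCtx C) M N ↔ ∀ D : Context, Solvable (D.plug M) → Solvable (D.plug N) := by
  rw [pLe_pCtx_iff, hC.forall]
  exact forall_congr' fun n => not_imp_not

theorem pLe_pCtx_of_den_le {M N : Term} (h : den M ≤ den N) : PLe (pCtx C) M N :=
  (pLe_pCtx_iff_forall hC).2 fun D hD => hD.mono (den_plug_mono D h)

theorem pEquiv_pCtx_of_den_eq {M N : Term} (h : den M = den N) : PEquiv (pCtx C) M N :=
  ⟨pLe_pCtx_of_den_le hC h.le, pLe_pCtx_of_den_le hC h.ge⟩

theorem PLe.plug {M N : Term} (h : PLe (pCtx C) M N) (D : Context) :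
    PLe (pCtx C) (D.plug M) (D.plug N) := by
  rw [pLe_pCtx_iff_forall hC] at *
  intro E
  rw [← Context.plug_comp, ← Context.plug_comp]
  exact h _

theorem PEquiv.plug {M N : Term} (h : PEquiv (pCtx C) M N) (D : Context) :
    PEquiv (pCtx C) (D.plug M) (D.plug N) :=
  ⟨PLe.plug hC h.1 D, PLe.plug hC h.2 D⟩

theorem isExtensionalLambdaTheory_pCtx : IsExtensionalLambdaTheory (PEquiv (pCtx C)) where
  equivalence := by
    have htrans {M N P : Term} (h₁ : PLe (pCtx C) M N) (h₂ : PLe (pCtx C) N P) :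
        PLe (pCtx C) M P :=
      pLe_pCtx_iff.2 ((pLe_pCtx_iff.1 h₂).trans (pLe_pCtx_iff.1 h₁))
    exact ⟨fun M => ⟨le_rfl, le_rfl⟩, fun h => ⟨h.2, h.1⟩,
      fun h₁ h₂ => ⟨htrans h₁.1 h₂.1, htrans h₂.2 h₁.2⟩⟩
  congr₁ M N P h := by
    obtain ⟨D, hD⟩ := Context.exists_plug_eq P
    simpa [Context.plug, hD] using PEquiv.plug hC h (.app .hole D)
  congr₂ M N P h := by
    obtain ⟨D, hD⟩ := Context.exists_plug_eq P
    simpa [Context.plug, hD] using PEquiv.plug hC h (.app D .hole)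
  xi x M N h := PEquiv.plug hC h (.abs x .hole)
  beta x M N := by
    refine pEquiv_pCtx_of_den_eq hC ?_
    rw [← inst_abs]
    exact (BetaEq.beta _ N).den_eq
  eta x M h := pEquiv_pCtx_of_den_eq hC (den_eq_of_sem_eq (sem_eta h)).symm

/-- If the context of index `n` is solvable at `M` but not at `N`, then `pCtx C N M` exceeds `pCtx C
M M` by at least `2⁻ⁿ`; radii up to `2⁻ⁿ` exclude this. -/
theorem exists_pBall_subset_solvable (M : Term) (s : Finset Context) :
    ∃ δ : ℝ≥0, 0 < δ ∧ ∀ N ∈ pBall (pCtx C) M δ, ∀ D ∈ s,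
      Solvable (D.plug M) → Solvable (D.plug N) := by
  classical
  induction s using Finset.induction_on with
  | empty => exact ⟨1, one_pos, by simp⟩
  | insert D s _ ih =>
    obtain ⟨δ, hδ, h⟩ := ih
    obtain ⟨n, rfl⟩ := hC D
    refine ⟨min δ (1 / 2 ^ n), by positivity, fun N hN D hD hM => ?_⟩
    have hN' : pCtx C N M < pCtx C M M + (min δ (1 / 2 ^ n) : ℝ≥0) := hN
    rcases Finset.mem_insert.1 hD with rfl | hD
    · by_contra hN₁
      have h₁ : weight (unsolvableIn C M) + 1 / 2 ^ n ≤
          weight (unsolvableIn C N ∪ unsolvableIn C M) :=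
        weight_add_le Set.subset_union_right (Or.inl hN₁) (not_not.2 hM)
      rw [pCtx_self, pCtx_eq] at hN'
      refine (h₁.trans_lt hN').not_ge ?_
      gcongr
      refine (ENNReal.coe_le_coe.2 (min_le_right _ _)).trans_eq ?_
      simp
    · refine h N (hN'.trans_le ?_) D hD hM
      gcongr
      exact min_le_left _ _

theorem isPContinuous_pCtx_plug (D : Context) : IsPContinuous (pCtx C) D.plug := by
  rintro U ⟨B, hB, rfl⟩
  refine ⟨{b | (∃ (M : Term) (ε : ℝ≥0), 0 < ε ∧ b = pBall (pCtx C) M ε) ∧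
    b ⊆ D.plug ⁻¹' ⋃₀ B}, fun b hb => hb.1, Set.Subset.antisymm ?_ ?_⟩
  · rintro M ⟨b, hb, hM⟩
    obtain ⟨P, ε, hε, rfl⟩ := hB b hb
    have hM' : pCtx C (D.plug M) P < pCtx C P P + ε := hM
    -- Indices outside `s` together weigh less than the slack with which `D[M]` lies in the ball
    -- around `P`.
    obtain ⟨s, hs⟩ := exists_finset_weight_compl_lt (tsub_pos_of_lt hM')
    classical
    -- For `n ∈ s`, solvability of `Cₙ[D[M]]` passes to `Cₙ[D[N]]`, so any new unsolvable index lies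
    -- outside `s`.
    obtain ⟨δ, hδ, h⟩ := exists_pBall_subset_solvable hC M (s.image fun n => (C n).comp D)
    refine ⟨pBall (pCtx C) M δ, ⟨⟨M, δ, hδ, rfl⟩, fun N hN => ⟨_, hb, ?_⟩⟩, ?_⟩
    · change pCtx C (D.plug N) P < pCtx C P P + ε
      refine (weight_le_add _ (unsolvableIn C (D.plug M) ∪ unsolvableIn C P)).trans_lt ?_
      rw [lt_tsub_iff_left] at hs
      refine lt_of_le_of_lt (add_le_add le_rfl (weight_mono ?_)) hs
      rintro n ⟨hn₁ | hn₁, hn₂⟩ hn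
      · refine hn₂ (Or.inl fun hn₃ => hn₁ ?_)
        rw [← Context.plug_comp] at hn₃ ⊢
        exact h N hN _ (Finset.mem_image_of_mem _ hn) hn₃
      · exact hn₂ (Or.inr hn₁)
    · exact ENNReal.lt_add_right (by rw [pCtx_self]; exact weight_ne_top _)
        (by exact_mod_cast hδ.ne')
  · rintro M ⟨b, hb, hM⟩
    exact hb.2 hM

theorem isSensible_pCtx : IsSensible (pCtx C) := by
  constructor
  · intro M hM N
    exact (pLe_pCtx_iff_forall hC).2 fun D hD => hD.plug_of_not_solvable hM N
  · intro M hM h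
    obtain ⟨N, hN⟩ := exists_not_solvable
    exact hN ((pLe_pCtx_iff_forall hC).1 (h N) .hole hM)

end

end LambdaCalc

theorem mainTheorem6 (C : ℕ → LambdaCalc.Context) (hC : Function.Surjective C) :
    LambdaCalc.IsExtensionalLambdaPPM (LambdaCalc.pCtx C) ∧
      LambdaCalc.IsSensible (LambdaCalc.pCtx C) :=
  ⟨⟨LambdaCalc.isPPM_pCtx C, LambdaCalc.isExtensionalLambdaTheory_pCtx hC,
    LambdaCalc.isPContinuous_pCtx_plug hC⟩, LambdaCalc.isSensible_pCtx hC⟩
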